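/- Let $\overrightarrow{G}$ be a finite digraph without loops or parallel arcs (a pair of opposite arcs is allowed), let $\beta,\gamma\in\mathbb{R}$, and let $H(\overrightarrow{G})=\beta D(\overrightarrow{G})+\gamma A(\overrightarrow{G})$, where $A(\overrightarrow{G})$ is the adjacency matrix ($a_{ij}=1$ if $(v_i,v_j)$ is an arc, $a_{ij}=0$ otherwise) and $D(\overrightarrow{G})$ is the diagonal matrix of the out-degrees $d^+(v_i)$. For a set $S$ of vertices, $H_S(\overrightarrow{G})$ denotes the principal submatrix of $H(\overrightarrow{G})$ obtained by deleting the rows and columns of the vertices in $S$, and $H_v=H_{\{v\}}$. For $n\ge1$, an $n\times n$ matrix $M=(m_{ij})$ and an integer $k$ with $1\le k\le n$, the hook immanant is $d_k(M)=\sum_{\sigma\in S_n}\chi_{(k,1^{n-k})}(\sigma)\prod_{i=1}^n m_{i\sigma(i)}$, where $\chi_\lambda$ is the irreducible character of $S_n$ indexed by the partition $\lambda$; if $k<1$ or $k>n$, then $d_k(M)=0$. For the empty ($0\times0$) matrix $\emptyset$ we set $d_k(\emptyset)=(-1)^k$ if $k\le0$ and $d_k(\emptyset)=0$ if $k>0$.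 Put $\Phi_k(M)=\Phi_k(M,x)=d_k(xI_n-M)\in\mathbb{R}[x]$. A consistently directed cycle $\overrightarrow{C}$ of $\overrightarrow{G}$ consists of $l\ge2$ distinct vertices in a cyclic order in which each vertex is joined to the next by an arc of $\overrightarrow{G}$ (so two opposite arcs form such a cycle with $l=2$); $V(\overrightarrow{C})$ is its vertex set. Let $\mathcal{C}_{\overrightarrow{G}}(v)$ and $\mathcal{C}_{\overrightarrow{G}}(\overrightarrow{e})$ be the sets of consistently directed cycles of $\overrightarrow{G}$ that contain the vertex $v$ and the arc $\overrightarrow{e}$, respectively. Then the following hold for every integer $k$. $(i)$ For every vertex $v$ of $\overrightarrow{G}$, $$\Phi_k(H(\overrightarrow{G}))=(x-\beta d^+(v))\bigl[\Phi_{k-1}(H_v(\overrightarrow{G}))+\Phi_k(H_v(\overrightarrow{G}))\bigr]+\sum_{\overrightarrow{C}\in\mathcal{C}_{\overrightarrow{G}}(v)}\gamma^{|V(\overrightarrow{C})|}\bigl[(-1)^{|V(\overrightarrow{C})|}\Phi_{k-|V(\overrightarrow{C})|}(H_{V(\overrightarrow{C})}(\overrightarrow{G}))-\Phi_k(H_{V(\overrightarrow{C})}(\overrightarrow{G}))\bigr].$$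 $(ii)$ For every arc $\overrightarrow{e}=(v,u)$ of $\overrightarrow{G}$, with $\overrightarrow{G}-\overrightarrow{e}$ the digraph obtained by deleting only this arc, $$\Phi_k(H(\overrightarrow{G}))=\Phi_k(H(\overrightarrow{G}-\overrightarrow{e}))-\beta\bigl[\Phi_k(H_v(\overrightarrow{G}-\overrightarrow{e}))+\Phi_{k-1}(H_v(\overrightarrow{G}-\overrightarrow{e}))\bigr]+\sum_{\overrightarrow{C}\in\mathcal{C}_{\overrightarrow{G}}(\overrightarrow{e})}\gamma^{|V(\overrightarrow{C})|}\bigl[(-1)^{|V(\overrightarrow{C})|}\Phi_{k-|V(\overrightarrow{C})|}(H_{V(\overrightarrow{C})}(\overrightarrow{G}))-\Phi_k(H_{V(\overrightarrow{C})}(\overrightarrow{G}))\bigr].$$ -/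

import Mathlib

open scoped Polynomial

/-! ### Irreducible characters of the symmetric group, via Specht modules -/

/-- The Young diagram of the hook partition `(a + 1, 1, …, 1)` with `b` ones after the first part.
Cells are pairs `(row, column)`, numbered from `0`. -/
def hookDiagram (a b : ℕ) : YoungDiagram where
  cells := ({0} : Finset ℕ) ×ˢ Finset.range (a + 1) ∪ Finset.range (b + 1) ×ˢ ({0} : Finset ℕ)
  isLowerSet := by
    rintro ⟨i, j⟩ ⟨i', j'⟩ hle h
    obtain ⟨h1, h2⟩ := Prod.mk_le_mk.mp hle
    simp only [Finset.coe_union, Finset.coe_product, Set.mem_union, Set.mem_prod, Finset.mem_coe,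
      Finset.mem_singleton, Finset.mem_range] at h ⊢
    omega

section Specht

variable {V : Type*} [Fintype V] [DecidableEq V]

/-- A (bijective) Young tableau of shape `μ` with entries in `V`. -/
abbrev YTableau (μ : YoungDiagram) (V : Type*) := {c : ℕ × ℕ // c ∈ μ.cells} ≃ V

/-- The row of the tableau `t` that contains the entry `w`. -/
def YTableau.rowOf {μ : YoungDiagram} (t : YTableau μ V) (w : V) : ℕ := (t.symm w).1.1

/-- The column of the tableau `t` that contains the entry `w`. -/
def YTableau.colOf {μ : YoungDiagram} (t : YTableau μ V) (w : V) : ℕ := (t.symm w).1.2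

/-- The action of `σ` on the free `ℚ`-module on row assignments `V → ℕ`. A tabloid (a tableau up to
reordering of each row) is identified with the function sending each entry to its row; `σ` replaces
the entry `w` by `σ w`. -/
noncomputable def rowAction (σ : Equiv.Perm V) : ((V → ℕ) →₀ ℚ) →ₗ[ℚ] ((V → ℕ) →₀ ℚ) :=
  Finsupp.lmapDomain ℚ ℚ (fun r w => r (σ⁻¹ w))

/-- The polytabloid of `t`: the signed sum `∑ sgn(π) π{t}` over the column stabilizer of `t`. -/
noncomputable def polytabloid {μ : YoungDiagram} (t : YTableau μ V) : (V → ℕ) →₀ ℚ :=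
  ∑ π : Equiv.Perm V with ∀ w, t.colOf (π w) = t.colOf w,
    ((Equiv.Perm.sign π : ℤ) : ℚ) • rowAction π (Finsupp.single t.rowOf 1)

/-- The Specht module of shape `μ`: the span of the polytabloids. -/
noncomputable def spechtModule (μ : YoungDiagram) (V : Type*) [Fintype V] [DecidableEq V] :
    Submodule ℚ ((V → ℕ) →₀ ℚ) :=
  Submodule.span ℚ (Set.range fun t : YTableau μ V => polytabloid t)

theorem rowAction_mul {W : Type*} (σ τ : Equiv.Perm W) (x : (W → ℕ) →₀ ℚ) :
    rowAction (σ * τ) x = rowAction σ (rowAction τ x) := by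
  simp only [rowAction, Finsupp.lmapDomain_apply, ← Finsupp.mapDomain_comp]
  rfl

theorem rowAction_polytabloid {μ : YoungDiagram} (σ : Equiv.Perm V) (t : YTableau μ V) :
    rowAction σ (polytabloid t) = polytabloid (t.trans σ : YTableau μ V) := by
  simp only [polytabloid, map_sum, map_smul, ← rowAction_mul]
  refine Finset.sum_equiv (MulAut.conj σ).toEquiv ?_ ?_
  · intro π
    simp only [Finset.mem_filter, Finset.mem_univ, true_and]
    constructor
    · intro h w
      simpa [YTableau.colOf] using h (σ⁻¹ w)
    · intro h w
      simpa [YTableau.colOf] using h (σ w)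
  · intro π _
    have h1 : Finsupp.single (YTableau.rowOf (t.trans σ : YTableau μ V)) (1 : ℚ)
        = rowAction σ (Finsupp.single t.rowOf 1) := by
      simp only [rowAction, Finsupp.lmapDomain_apply, Finsupp.mapDomain_single]
      rfl
    rw [h1, ← rowAction_mul]
    have h2 : Equiv.Perm.sign (σ * π * σ⁻¹) = Equiv.Perm.sign π := by
      rw [map_mul, map_mul, mul_comm, ← mul_assoc, ← map_mul, inv_mul_cancel, map_one, one_mul]
    change _ = ((Equiv.Perm.sign (σ * π * σ⁻¹) : ℤ) : ℚ) • rowAction (σ * π * σ⁻¹ * σ) _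
    rw [h2, inv_mul_cancel_right]

theorem rowAction_mem_spechtModule (μ : YoungDiagram) (σ : Equiv.Perm V) :
    ∀ x ∈ spechtModule μ V, rowAction σ x ∈ spechtModule μ V := by
  intro x hx
  induction hx using Submodule.span_induction with
  | mem x h =>
    obtain ⟨t, rfl⟩ := h
    exact Submodule.subset_span ⟨_, (rowAction_polytabloid σ t).symm⟩
  | zero => simp
  | add x y _ _ hx hy => rw [map_add]; exact Submodule.add_mem _ hx hy
  | smul a x _ hx => rw [map_smul]; exact Submodule.smul_mem _ a hx

/-- The irreducible character `χ_μ` of the symmetric group on `V`, for a partition `μ` of `|V|`: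
the character of the Specht module of shape `μ`. -/
noncomputable def spechtCharacter (μ : YoungDiagram) (σ : Equiv.Perm V) : ℚ :=
  LinearMap.trace ℚ (spechtModule μ V)
    ((rowAction σ).restrict (rowAction_mem_spechtModule μ σ))

/-- The immanant `d_μ(M) = ∑_σ χ_μ(σ) ∏_i M i (σ i)`. -/
noncomputable def immanant {R : Type*} [CommRing R] [Algebra ℚ R] (μ : YoungDiagram)
    (M : Matrix V V R) : R :=
  ∑ σ : Equiv.Perm V, spechtCharacter μ σ • ∏ i, M i (σ i)

/-- The hook immanant `d_k(M)` of an `n × n` matrix: for `n ≥ 1` it is the immanant of the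
partition `(k, 1^{n-k})` if `1 ≤ k ≤ n`, and `0` if `k < 1` or `k > n`.
For the `0 × 0` matrix, `d_k = (-1)^k` if `k ≤ 0` and `d_k = 0` if `k > 0`: this is the value that
the Jacobi–Trudi straightening rule gives to the "hook" `(k, 1^{-k})` of size `0`; in particular
`d_0 = 1`, the immanant of the empty partition. -/
noncomputable def hookImmanant {R : Type*} [CommRing R] [Algebra ℚ R] (k : ℤ)
    (M : Matrix V V R) : R :=
  if Fintype.card V = 0 then
    if k ≤ 0 then (-1) ^ k.natAbs else 0
  else if 1 ≤ k ∧ k ≤ (Fintype.card V : ℤ) then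
    immanant (hookDiagram (k - 1).toNat ((Fintype.card V : ℤ) - k).toNat) M
  else 0

/-- The hook immanantal polynomial `Φ_k(M) = d_k(x I - M)`, a polynomial in `x`. -/
noncomputable def hookPoly (k : ℤ) (M : Matrix V V ℝ) : ℝ[X] :=
  hookImmanant k (Matrix.charmatrix M)

end Specht

/-! ### Matrices of digraphs -/

section Digraphs

variable {V : Type*} [Fintype V] [DecidableEq V]

open Classical in
/-- The out-degree of `v`. -/
noncomputable def outDeg (G : Digraph V) (v : V) : ℕ :=
  (Finset.univ.filter fun w => G.Adj v w).card

open Classical in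
/-- The adjacency matrix of a digraph. -/
noncomputable def digraphAdjMatrix (G : Digraph V) : Matrix V V ℝ :=
  Matrix.of fun v w => if G.Adj v w then 1 else 0

/-- The diagonal matrix of out-degrees. -/
noncomputable def outDegMatrix (G : Digraph V) : Matrix V V ℝ :=
  Matrix.diagonal fun v => (outDeg G v : ℝ)

/-- `H(G) = β D(G) + γ A(G)`. -/
noncomputable def digraphH (β γ : ℝ) (G : Digraph V) : Matrix V V ℝ :=
  β • outDegMatrix G + γ • digraphAdjMatrix G

/-- `H_S(G)`: the principal submatrix of `H(G)` obtained by deleting the rows and columns of the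
vertices in `S` (the diagonal entries keep the out-degrees in `G`). -/
noncomputable def digraphHDel (β γ : ℝ) (G : Digraph V) (S : Finset V) :
    Matrix {w : V // w ∉ S} {w : V // w ∉ S} ℝ :=
  (digraphH β γ G).submatrix Subtype.val Subtype.val

/-- The digraph obtained by deleting the arc `(v, u)`. -/
def deleteArc (G : Digraph V) (v u : V) : Digraph V where
  Adj a b := G.Adj a b ∧ ¬ (a = v ∧ b = u)

/-- The finite type of cyclic sequences, up to rotation, of at least two pairwise distinct
vertices. -/
abbrev VertexCycle (V : Type*) := {c : Cycle V // c.Nodup ∧ c.Nontrivial}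

open Classical in
/-- The consistently directed cycles of `G`: each vertex of the cyclic sequence is joined to the
next one by an arc. A pair of opposite arcs is a directed cycle of length two. -/
noncomputable def directedCycles (G : Digraph V) : Finset (VertexCycle V) :=
  Finset.univ.filter fun c => c.1.Chain G.Adj

/-- The set `V(C)` of vertices of a cycle. -/
def cycleVerts (c : VertexCycle V) : Finset V := c.1.toFinset

open Classical in
/-- The consistently directed cycles of `G` that contain the vertex `v`. -/
noncomputable def cyclesThroughVertex (G : Digraph V) (v : V) : Finset (VertexCycle V) :=
  (directedCycles G).filter fun c => v ∈ c.1

open Classical in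
/-- The consistently directed cycles of `G` that contain the arc `(v, u)`, that is, in which `v` is
immediately followed by `u`. -/
noncomputable def cyclesThroughArc (G : Digraph V) (v u : V) : Finset (VertexCycle V) :=
  (directedCycles G).filter fun c => ∃ hv : v ∈ c.1, c.1.next c.2.1 v hv = u

/-- The contribution of a cycle `C`:
`γ^{|V(C)|} [(-1)^{|V(C)|} Φ_{k-|V(C)|}(H_{V(C)}(G)) - Φ_k(H_{V(C)}(G))]`. -/
noncomputable def cycleTerm (β γ : ℝ) (G : Digraph V) (k : ℤ) (c : VertexCycle V) : ℝ[X] :=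
  Polynomial.C (γ ^ (cycleVerts c).card) *
    ((-1) ^ (cycleVerts c).card *
        hookPoly (k - (cycleVerts c).card) (digraphHDel β γ G (cycleVerts c)) -
      hookPoly k (digraphHDel β γ G (cycleVerts c)))

end Digraphs

/-! The hook `(k, 1^b)` with `b = n - k` carries the `b`-th exterior power of the standard
representation. Since `Λ^b(ℚ^V) = Λ^b(std) ⊕ Λ^(b-1)(std)`, its character is an alternating sum,
over the `σ`-invariant sets `S` with `|S| ≤ b`, of the sign of `σ` on `S`. This is `hookChar`.

For the Specht module this is proved by a trace computation. A Garnir relation gives a reproducing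
formula `∑_d x(d) e_d = n b! x` over `(b+1)`-tuples `d`, where `e_d` is the polytabloid with first
column `d` (`sum_rowMap_smul_of_mem`). It writes the action of `σ` as a sum of rank-one maps, so `n
b!` times the character is a signed count (`pointedCount`). A recursion on `b` evaluates that count
(`pointedCount_eq`), giving `spechtCharacter_hookDiagram`.

If `σ` consists of a cycle on `S` and a permutation `τ` of the complement, an invariant set contains
`S` or misses it. Hence `χ_b(σ) = χ_b(τ) - (-1)^|S| χ_(b-|S|)(τ)` (`hookChar_mul_ofSubtype`).
Grouping permutations by their cycle through `v` expands any hook immanant (`hookImmanant_expand`).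
For `xI - H` this is (i). Part (ii) is the difference of (i) at the tail `v` for the digraphs with
and without the arc, since only row `v` of `H` changes. -/

namespace HookImmanant

open Equiv Equiv.Perm

/-! ### Alternating sums over symmetric groups. -/

section SignedSums

variable {J A : Type*} [Fintype J] [DecidableEq J] [AddCommGroup A]

theorem sum_sign_smul_eq_zero_of_swap_mul (g : Perm J → A) {a b : J} (hab : a ≠ b)
    (h : ∀ π, g (swap a b * π) = g π) : ∑ π : Perm J, (sign π : ℤ) • g π = 0 := by
  refine Finset.sum_involution (fun π _ => swap a b * π) ?_ ?_ (fun _ _ => Finset.mem_univ _) ?_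
  · intro π _
    simp [h, sign_swap hab]
  · intro π _ _ he
    exact hab (swap_eq_one_iff.mp (mul_eq_right.mp he))
  · intro π _
    simp [← mul_assoc]

theorem sum_sign_smul_eq_zero_of_mul_swap (g : Perm J → A) {a b : J} (hab : a ≠ b)
    (h : ∀ π, g (π * swap a b) = g π) : ∑ π : Perm J, (sign π : ℤ) • g π = 0 := by
  refine Finset.sum_involution (fun π _ => π * swap a b) ?_ ?_ (fun _ _ => Finset.mem_univ _) ?_
  · intro π _
    simp [h, sign_swap hab]
  · intro π _ _ he
    exact hab (swap_eq_one_iff.mp (mul_eq_left.mp he))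
  · intro π _
    simp [mul_assoc]

/-- The antisymmetrization of a function of `J`-tuples. -/
def antisymm {V : Type*} (f : (J → V) → A) (c : J → V) : A :=
  ∑ π : Perm J, (sign π : ℤ) • f (c ∘ π)

theorem antisymm_eq_zero_of_not_injective {V : Type*} (f : (J → V) → A) {c : J → V}
    (hc : ¬ Function.Injective c) : antisymm f c = 0 := by
  simp only [Function.Injective, not_forall] at hc
  obtain ⟨a, b, hab, hne⟩ := hc
  refine sum_sign_smul_eq_zero_of_swap_mul (fun π => f (c ∘ π)) hne fun π => ?_
  congr 1
  funext j
  simp only [Function.comp_apply, Perm.mul_apply, swap_apply_def]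
  split_ifs with h1 h2 <;> simp_all

theorem antisymm_comp_perm {V : Type*} (f : (J → V) → A) (c : J → V) (τ : Perm J) :
    antisymm f (c ∘ τ) = (sign τ : ℤ) • antisymm f c := by
  rw [antisymm, antisymm, Finset.smul_sum,
    ← Equiv.sum_comp (Equiv.mulLeft τ) fun π => (sign τ : ℤ) • (sign π : ℤ) • f (c ∘ π)]
  refine Finset.sum_congr rfl fun π _ => ?_
  have h : (sign τ : ℤ) * sign (τ * π) = sign π := by
    rw [map_mul, Units.val_mul, ← mul_assoc, Int.units_coe_mul_self, one_mul]
  rw [smul_smul, coe_mulLeft, h]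
  rfl

/-- The condition sees `π` only through `d ∘ π`, so the sum is an antisymmetrization at a tuple with
a repeated entry. -/
theorem sum_perm_eq_zero_of_not_injective {V : Type*} [DecidableEq V] (P : J → Prop)
    [DecidablePred P] (σ : Perm V) {d : J → V} (hd : ¬ Function.Injective d) :
    ∑ π : Perm J, (sign π : ℤ) * (if ∀ j, P j → σ (d (π j)) = d j then 1 else 0) = 0 := by
  have := antisymm_eq_zero_of_not_injective
    (fun c : J → V => if ∀ j, P j → σ (c j) = d j then (1 : ℤ) else 0) hd
  simpa only [antisymm, smul_eq_mul, Function.comp_apply] using this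

/-- A Garnir relation for tuples of which all but one coordinate matter. -/
theorem sum_antisymm_update {V : Type*} (f : (J → V) → A) (o : J)
    (hf : ∀ c v, f (Function.update c o v) = f c) (c : J → V) (v : V) :
    ∑ q : J, antisymm f (Function.update c q v) = antisymm f c := by
  have hup : ∀ (π : Perm J) (j : J),
      Function.update c (π j) v ∘ π = Function.update (c ∘ π) j v := fun π j => by
    funext i
    by_cases h : i = j <;> simp [h]
  have h1 : ∑ q : J, antisymm f (Function.update c q v)
      = ∑ j : J, ∑ π : Perm J, (sign π : ℤ) • f (Function.update (c ∘ π) j v) := by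
    simp only [antisymm]
    rw [Finset.sum_comm, Finset.sum_comm (s := (Finset.univ : Finset J))]
    refine Finset.sum_congr rfl fun π _ => ?_
    rw [← Equiv.sum_comp π]
    simp only [hup]
  rw [h1, Finset.sum_eq_single o]
  · simp only [hf, antisymm]
  · intro j _ hj
    -- With coordinate `j` overwritten and coordinate `o` ignored, the value does not distinguish
    -- `π` from `π * swap j o`, and these have opposite signs.
    refine sum_sign_smul_eq_zero_of_mul_swap _ hj fun π => ?_
    rw [← hf _ (c (π j)), ← hf (Function.update (c ∘ π) j v) (c (π j))]
    congr 1
    funext i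
    by_cases hi : i = o
    · simp [hi]
    · by_cases hij : i = j
      · simp [hij, hj]
      · simp [hi, hij, swap_apply_of_ne_of_ne]
  · simp

end SignedSums

/-! ### The hook character as a signed count of tuples. -/

section Counts

variable {V : Type*} [Fintype V] [DecidableEq V]

/-- The sign of the restriction of `σ` to `S` if `S` is `σ`-invariant, and `0` otherwise. -/
def invariantSign (σ : Perm V) (S : Finset V) : ℤ :=
  if h : ∀ x, σ x ∈ S ↔ x ∈ S then (sign (σ.subtypePerm h) : ℤ) else 0

/-- The value at `σ` of the character of the hook with leg length `b`, as an alternating sum over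
`σ`-invariant sets. It is defined for every integer `b`. -/
def hookChar (b : ℤ) (σ : Perm V) : ℤ :=
  ∑ S : Finset V, if (S.card : ℤ) ≤ b then (-1) ^ (b - S.card).natAbs * invariantSign σ S else 0

/-- The right side is the trace of `σ` on `Λ^b(ℚ^V)`; on the left the terms with `|S| < b` cancel.
-/
theorem hookChar_add_hookChar_sub_one (b : ℤ) (σ : Perm V) :
    hookChar b σ + hookChar (b - 1) σ =
      ∑ S : Finset V, if (S.card : ℤ) = b then invariantSign σ S else 0 := by
  rw [hookChar, hookChar, ← Finset.sum_add_distrib]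
  refine Finset.sum_congr rfl fun S _ => ?_
  rcases lt_trichotomy (S.card : ℤ) b with h | h | h
  · rw [if_pos h.le, if_pos (by omega), if_neg h.ne,
      show (b - S.card).natAbs = (b - 1 - S.card).natAbs + 1 by omega, pow_succ]
    ring
  · rw [if_pos h.le, if_neg (by omega), if_pos h]
    simp [h]
  · rw [if_neg (by omega), if_neg (by omega), if_neg h.ne', add_zero]

theorem hookChar_of_neg {b : ℤ} (hb : b < 0) (σ : Perm V) : hookChar b σ = 0 :=
  Finset.sum_eq_zero fun S _ => if_neg (by omega)

/-- The signed number of pairs `(d, π)` with `σ ∘ d ∘ π = d` away from `o`. -/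
def pointedCount {J : Type*} [Fintype J] [DecidableEq J] (σ : Perm V) (o : J) : ℤ :=
  ∑ d : J → V, ∑ π : Perm J, (sign π : ℤ) * if ∀ j, j ≠ o → σ (d (π j)) = d j then 1 else 0

/-- The signed number of pairs `(d, π)` with `σ ∘ d ∘ π = d`. -/
def alternatingCount (L : Type*) [Fintype L] [DecidableEq L] (σ : Perm V) : ℤ :=
  ∑ d : L → V, ∑ π : Perm L, (sign π : ℤ) * if ∀ j, σ (d (π j)) = d j then 1 else 0

theorem pointedCount_congr {J K : Type*} [Fintype J] [DecidableEq J] [Fintype K] [DecidableEq K]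
    (σ : Perm V) (e : J ≃ K) (o : J) : pointedCount σ (e o) = pointedCount σ o := by
  unfold pointedCount
  rw [← (e.arrowCongr (Equiv.refl V)).sum_comp]
  refine Finset.sum_congr rfl fun d _ => ?_
  rw [← (e.permCongr).sum_comp]
  refine Finset.sum_congr rfl fun π _ => ?_
  rw [sign_permCongr]
  congr 2
  rw [← e.forall_congr_right]
  simp [Equiv.arrowCongr_apply]

theorem pointedCount_eq_zero {J : Type*} [Fintype J] [DecidableEq J] (σ : Perm V) (o : J)
    (h : Fintype.card V < Fintype.card J) : pointedCount σ o = 0 :=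
  Finset.sum_eq_zero fun _ _ => sum_perm_eq_zero_of_not_injective (fun j => j ≠ o) σ
    fun hd => h.not_ge (Fintype.card_le_of_injective _ hd)

/-- Permutations of `Option L` fixing `none` leave the entry at `none` free, giving the first term.
Any other one is a transposition with `none` times a permutation of `L`; it forces that entry, drops
one condition, and changes the sign. -/
theorem pointedCount_none {L : Type*} [Fintype L] [DecidableEq L] (σ : Perm V) :
    pointedCount σ (none : Option L) =
      Fintype.card V * alternatingCount L σ - ∑ l : L, pointedCount σ l := by
  have hsplit : ∀ F : (Option L → V) → ℤ,
      ∑ d : Option L → V, F d = ∑ i : L → V, ∑ v : V, F (fun o => o.elim v i) := by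
    intro F
    rw [← (Equiv.piOptionEquivProd (β := fun _ : Option L => V)).symm.sum_comp,
      Fintype.sum_prod_type, Finset.sum_comm]
    refine Finset.sum_congr rfl fun i _ => Finset.sum_congr rfl fun v _ => congrArg F ?_
    funext o
    cases o <;> rfl
  have key : ∀ (i : L → V) (e : Perm L) (l : L),
      ∑ v : V, (if ∀ j : Option L, j ≠ none → σ ((fun o : Option L => o.elim v i)
          ((decomposeOption.symm (some (e l), e)) j)) = (fun o : Option L => o.elim v i) j
        then (1 : ℤ) else 0) = if ∀ j, j ≠ l → σ (i (e j)) = i j then 1 else 0 := by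
    intro i e l
    -- The permutation sends `some l` to `none`, so the condition at `some l` reads `σ v = i l`.
    rw [Finset.sum_eq_single (σ⁻¹ (i l))]
    · refine if_congr ?_ rfl rfl
      constructor
      · intro h j hj
        have := h (some j) (by simp)
        simpa [swap_apply_of_ne_of_ne, hj] using this
      · intro h j hj
        obtain ⟨j, rfl⟩ := Option.ne_none_iff_exists'.mp hj
        by_cases hjl : j = l
        · simp [hjl]
        · simpa [swap_apply_of_ne_of_ne, hjl] using h j hjl
    · intro v _ hv
      refine if_neg fun h => hv ?_
      have := h (some l) (by simp)
      simp only [decomposeOption_symm_apply, Perm.mul_apply, optionCongr_apply, Option.map_some,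
        swap_apply_right, Option.elim_none, Option.elim_some] at this
      rw [← this, ← Perm.mul_apply, inv_mul_cancel, Perm.one_apply]
    · simp
  rw [pointedCount, hsplit]
  have hin : ∀ i : L → V, ∑ v : V, ∑ π : Perm (Option L), (sign π : ℤ) *
      (if ∀ j, j ≠ none → σ ((fun o : Option L => o.elim v i) (π j))
        = (fun o : Option L => o.elim v i) j then 1 else 0)
      = Fintype.card V * (∑ e : Perm L, (sign e : ℤ) * if ∀ j, σ (i (e j)) = i j then 1 else 0)
        - ∑ l : L, ∑ e : Perm L, (sign e : ℤ) *
          if ∀ j, j ≠ l → σ (i (e j)) = i j then 1 else 0 := by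
    intro i
    rw [Finset.sum_comm, ← decomposeOption.symm.sum_comp, Fintype.sum_prod_type, Fintype.sum_option,
      sub_eq_add_neg]
    congr 1
    · rw [Finset.mul_sum]
      refine Finset.sum_congr rfl fun e _ => ?_
      rw [decomposeOption_symm_sign, ← Finset.mul_sum]
      have : ∀ v : V, (∀ j : Option L, j ≠ none → σ ((fun o : Option L => o.elim v i)
          ((decomposeOption.symm (none, e)) j)) = (fun o : Option L => o.elim v i) j) ↔
          ∀ j, σ (i (e j)) = i j := by
        intro v
        simp [Option.forall]
      simp only [this, Finset.sum_const, Finset.card_univ, nsmul_eq_mul]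
      ring
    · rw [Finset.sum_comm, Finset.sum_comm (s := (Finset.univ : Finset L)),
        ← Finset.sum_neg_distrib]
      refine Finset.sum_congr rfl fun e _ => ?_
      rw [← Equiv.sum_comp e, ← Finset.sum_neg_distrib]
      refine Finset.sum_congr rfl fun l _ => ?_
      rw [← Finset.mul_sum, key]
      have : sign (decomposeOption.symm (some (e l), e)) = - sign e := by
        simp
      rw [this, Units.val_neg, neg_mul]
  rw [Finset.sum_congr rfl fun i _ => hin i, Finset.sum_sub_distrib, ← Finset.mul_sum,
    alternatingCount, Finset.sum_comm (s := (Finset.univ : Finset (L → V))) (t := (Finset.univ : Finset L))]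
  rfl

/-- At most one `π` satisfies `d ∘ π = σ⁻¹ ∘ d`. It exists exactly when the image of `d` is
invariant, and is then conjugate to the inverse of the restriction of `σ`, which has the same sign.
-/
theorem sum_perm_eq_invariantSign {L : Type*} [Fintype L] [DecidableEq L] (σ : Perm V)
    {d : L → V} (hd : Function.Injective d) :
    ∑ π : Perm L, (sign π : ℤ) * (if ∀ j, σ (d (π j)) = d j then 1 else 0)
      = invariantSign σ (Finset.univ.image d) := by
  unfold invariantSign
  split_ifs with h
  · let e : L ≃ {x // x ∈ Finset.univ.image d} :=
      Equiv.ofBijective (fun l => ⟨d l, by simp⟩)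
        ⟨fun a b hab => hd (congrArg Subtype.val hab), by rintro ⟨x, hx⟩; simpa using hx⟩
    have hinv : ∀ j, σ (d (e.symm ((σ.subtypePerm h)⁻¹ (e j)))) = d j := by
      intro j
      have h1 : ∀ y, d (e.symm y) = y.1 := fun y => congrArg Subtype.val (e.apply_symm_apply y)
      rw [h1]
      exact congrArg Subtype.val ((σ.subtypePerm h).apply_symm_apply (e j))
    rw [Finset.sum_eq_single (e.symm.permCongr (σ.subtypePerm h)⁻¹)]
    · rw [if_pos fun j => by simpa [permCongr_apply] using hinv j, sign_permCongr, sign_inv, mul_one]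
    · intro π _ hπ
      rw [if_neg fun hj => hπ ?_, mul_zero]
      ext j
      apply hd
      apply σ.injective
      rw [hj]
      simpa [permCongr_apply] using (hinv j).symm
    · simp
  · refine Finset.sum_eq_zero fun π _ => ?_
    rw [if_neg fun hj => h ?_, mul_zero]
    intro x
    simp only [Finset.mem_image, Finset.mem_univ, true_and]
    constructor
    · rintro ⟨j, hx⟩
      exact ⟨π j, σ.injective ((hj j).trans hx)⟩
    · rintro ⟨j, rfl⟩
      exact ⟨π⁻¹ j, by rw [← hj]; simp⟩

theorem card_injective_image_eq {L : Type*} [Fintype L] [DecidableEq L] (S : Finset V)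
    (hS : S.card = Fintype.card L) :
    (Finset.univ.filter fun d : L → V =>
      Function.Injective d ∧ Finset.univ.image d = S).card = (Fintype.card L).factorial := by
  have e0 : L ≃ S := Fintype.equivOfCardEq (by simp [hS])
  rw [← Fintype.card_equiv e0, ← Fintype.card_subtype]
  refine Fintype.card_congr
    { toFun := fun d => Equiv.ofBijective
        (fun l => ⟨d.1 l, by simp [← d.2.2]⟩)
        ⟨fun a b hab => d.2.1 (congrArg Subtype.val hab), fun ⟨x, hx⟩ => by
          rw [← d.2.2] at hx
          simpa using hx⟩
      invFun := fun e => ⟨fun l => e l, Subtype.val_injective.comp e.injective, by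
        ext x
        simp only [Finset.mem_image, Finset.mem_univ, true_and]
        refine ⟨?_, fun hx => ⟨e.symm ⟨x, hx⟩, by simp⟩⟩
        rintro ⟨l, rfl⟩
        exact (e l).2⟩
      left_inv := fun _ => rfl
      right_inv := fun e => by ext; rfl }

theorem alternatingCount_eq {L : Type*} [Fintype L] [DecidableEq L] (σ : Perm V) :
    alternatingCount L σ = (Fintype.card L).factorial *
      ∑ S : Finset V, if S.card = Fintype.card L then invariantSign σ S else 0 := by
  have h1 : alternatingCount L σ = ∑ d : L → V,
      if Function.Injective d then invariantSign σ (Finset.univ.image d) else 0 := by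
    refine Finset.sum_congr rfl fun d _ => ?_
    split_ifs with hd
    · exact sum_perm_eq_invariantSign σ hd
    · simpa using sum_perm_eq_zero_of_not_injective (fun _ => True) σ hd
  rw [h1, ← Finset.sum_filter,
    ← Finset.sum_fiberwise (g := fun d : L → V => Finset.univ.image d), Finset.mul_sum]
  refine Finset.sum_congr rfl fun S _ => ?_
  rw [Finset.filter_filter]
  split_ifs with hS
  · rw [Finset.sum_congr rfl (g := fun _ => invariantSign σ S), Finset.sum_const,
      card_injective_image_eq S hS, nsmul_eq_mul]
    intro d hd
    rw [(Finset.mem_filter.mp hd).2.2]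
  · rw [mul_zero, Finset.sum_eq_zero]
    intro d hd
    obtain ⟨-, hinj, rfl⟩ := Finset.mem_filter.mp hd
    exact absurd (Finset.card_image_of_injective _ hinj) hS

/-- Divided by `n b!`, the recursion of `pointedCount_none` becomes `hookChar_add_hookChar_sub_one`.
-/
theorem pointedCount_eq (b : ℕ) {J : Type*} [Fintype J] [DecidableEq J] (σ : Perm V) (o : J)
    (hJ : Fintype.card J = b + 1) :
    pointedCount σ o = Fintype.card V * b.factorial * hookChar b σ := by
  induction b generalizing J with
  | zero =>
    have hL : Fintype.card {j // j ≠ o} = 0 := by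
      rw [Fintype.card_subtype_compl, hJ]; simp
    have := Fintype.card_eq_zero_iff.mp hL
    have hc := hookChar_add_hookChar_sub_one 0 σ
    rw [hookChar_of_neg (by norm_num : (0 : ℤ) - 1 < 0), add_zero] at hc
    -- `o` is the image of `none` under `Option {j // j ≠ o} ≃ J`.
    rw [← optionSubtypeNe_none o, pointedCount_congr, pointedCount_none, alternatingCount_eq, hL]
    simp only [Nat.cast_zero, hc]
    simp
  | succ b ih =>
    have hL : Fintype.card {j // j ≠ o} = b + 1 := by
      rw [Fintype.card_subtype_compl, hJ]; simp
    have hc := hookChar_add_hookChar_sub_one ((b + 1 : ℕ) : ℤ) σ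
    rw [← optionSubtypeNe_none o, pointedCount_congr, pointedCount_none, alternatingCount_eq, hL,
      Finset.sum_congr rfl fun l _ => ih l hL, Finset.sum_const, Finset.card_univ, hL]
    simp only [Nat.cast_inj] at hc
    rw [← hc, Nat.factorial_succ]
    push_cast
    rw [add_sub_cancel_right]
    simp only [nsmul_eq_mul]
    push_cast
    ring

/-- No `(b+1)`-tuple is injective, so the count vanishes. Dividing by `n b!` needs `n ≠ 0`: on the
empty set `hookChar b` is `(-1)^b` for every `b ≥ 0`. -/
theorem hookChar_eq_zero_of_card_le [Nonempty V] {b : ℤ} (hb : (Fintype.card V : ℤ) ≤ b)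
    (σ : Perm V) : hookChar b σ = 0 := by
  lift b to ℕ using by omega
  have h := pointedCount_eq b σ (0 : Fin (b + 1)) (by simp)
  rw [pointedCount_eq_zero σ _ (by simp; omega), eq_comm, mul_eq_zero] at h
  refine h.resolve_left ?_
  exact_mod_cast mul_ne_zero Fintype.card_ne_zero b.factorial_ne_zero

end Counts

/-! ### Hook polytabloids indexed by first columns. -/

variable {V : Type*} [Fintype V] [DecidableEq V]

/-- The row assignment of a hook tableau whose first column is `c`. -/
def rowMap {V : Type*} [DecidableEq V] {b : ℕ} (c : Fin (b + 1) → V) (w : V) : ℕ :=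
  ∑ j, if c j = w then (j : ℕ) else 0

/-- The polytabloid of a hook tableau whose first column is `c`. -/
noncomputable def hookPolytabloid {V : Type*} [DecidableEq V] {b : ℕ} (c : Fin (b + 1) → V) :
    (V → ℕ) →₀ ℚ :=
  antisymm (fun d : Fin (b + 1) → V => Finsupp.single (rowMap d) 1) c

section Rows

variable {V : Type*} [DecidableEq V] {b : ℕ}

theorem rowMap_update_zero (c : Fin (b + 1) → V) (v : V) :
    rowMap (Function.update c 0 v) = rowMap c := by
  funext w
  refine Finset.sum_congr rfl fun j _ => ?_
  by_cases hj : j = 0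
  · simp [hj]
  · simp [hj]

theorem rowMap_apply {c : Fin (b + 1) → V} (hc : Function.Injective c) (j : Fin (b + 1)) :
    rowMap c (c j) = j := by
  simp [rowMap, hc.eq_iff]

theorem rowMap_of_notMem {c : Fin (b + 1) → V} {w : V} (hw : ∀ j, c j ≠ w) : rowMap c w = 0 := by
  simp [rowMap, hw]

theorem rowMap_perm_comp (σ : Perm V) (c : Fin (b + 1) → V) :
    rowMap (σ ∘ c) = fun w => rowMap c (σ⁻¹ w) := by
  funext w
  refine Finset.sum_congr rfl fun j _ => if_congr ?_ rfl rfl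
  rw [Perm.inv_def, Equiv.eq_symm_apply]
  rfl

/-- The entry at index `0` lies in row `0`, as do all entries outside the tuple, so a tabloid
forgets exactly that coordinate. -/
theorem rowMap_eq_iff {c d : Fin (b + 1) → V} (hc : Function.Injective c)
    (hd : Function.Injective d) : rowMap c = rowMap d ↔ ∀ j, j ≠ 0 → c j = d j := by
  constructor
  · intro h j hj
    by_contra hne
    have h1 : rowMap d (c j) = j := by rw [← h, rowMap_apply hc]
    by_cases hex : ∃ i, d i = c j
    · obtain ⟨i, hi⟩ := hex
      rw [← hi, rowMap_apply hd] at h1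
      exact hne (by rw [← hi, Fin.ext h1])
    · rw [rowMap_of_notMem fun i hi => hex ⟨i, hi⟩] at h1
      exact hj (Fin.ext h1.symm)
  · intro h
    rw [← rowMap_update_zero c (d 0)]
    congr 1
    funext j
    by_cases hj : j = 0
    · simp [hj]
    · simp [hj, h j hj]

theorem rowAction_hookPolytabloid (σ : Perm V) (c : Fin (b + 1) → V) :
    rowAction σ (hookPolytabloid c) = hookPolytabloid (σ ∘ c) := by
  simp only [hookPolytabloid, antisymm, map_sum, map_zsmul]
  refine Finset.sum_congr rfl fun π _ => ?_
  rw [Function.comp_assoc, rowMap_perm_comp]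
  simp [rowAction]

theorem sum_perm_fin_apply_zero {A : Type*} [AddCommMonoid A] (h : Fin (b + 1) → A) :
    ∑ π : Perm (Fin (b + 1)), h (π 0) = b.factorial • ∑ q, h q := by
  rw [← decomposeFin.symm.sum_comp, Fintype.sum_prod_type, Finset.smul_sum]
  refine Finset.sum_congr rfl fun q _ => ?_
  simp [Fintype.card_perm]

end Rows

theorem hookPolytabloid_apply {b : ℕ} (c d : Fin (b + 1) → V) :
    hookPolytabloid c (rowMap d) =
      ((∑ π : Perm (Fin (b + 1)), (sign π : ℤ) *
        if rowMap (c ∘ π) = rowMap d then 1 else 0 : ℤ) : ℚ) := by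
  rw [hookPolytabloid, antisymm, Finsupp.finsetSum_apply]
  push_cast
  refine Finset.sum_congr rfl fun π _ => ?_
  rw [Pi.smul_apply, Finsupp.single_apply, zsmul_eq_mul]

theorem sum_ite_agree_smul {b : ℕ} {A : Type*} [AddCommMonoid A] (c : Fin (b + 1) → V)
    (F : (Fin (b + 1) → V) → A) :
    (∑ d, if ∀ j, j ≠ 0 → c j = d j then F d else 0) = ∑ v : V, F (Function.update c 0 v) := by
  rw [← Finset.sum_filter]
  refine Finset.sum_bij' (fun d _ => d 0) (fun v _ => Function.update c 0 v) ?_ ?_ ?_ ?_ ?_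
  · simp
  · intro v _
    simp only [Finset.mem_filter, Finset.mem_univ, true_and]
    intro j hj
    simp [hj]
  · intro d hd
    have hd := (Finset.mem_filter.mp hd).2
    funext j
    by_cases hj : j = 0
    · simp [hj]
    · simp [hj, hd j hj]
  · simp
  · intro d hd
    have hd := (Finset.mem_filter.mp hd).2
    congr 1
    funext j
    by_cases hj : j = 0
    · simp [hj]
    · simp [hj, hd j hj]

/-- The coefficient at `d` collects the `π` for which `c ∘ π` and `d` agree off `0`. Summing over
such `d` replaces the entry at `π 0` of `c` by an arbitrary `v`. Each position is `π 0` for `b!`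
permutations, and the Garnir relation returns `hookPolytabloid c` for each of the `n` values of `v`.
-/
theorem sum_rowMap_smul_hookPolytabloid {b : ℕ} {c : Fin (b + 1) → V}
    (hc : Function.Injective c) :
    ∑ d : Fin (b + 1) → V, hookPolytabloid c (rowMap d) • hookPolytabloid d =
      (Fintype.card V * b.factorial : ℚ) • hookPolytabloid c := by
  have h1 : ∀ d : Fin (b + 1) → V, hookPolytabloid c (rowMap d) • hookPolytabloid d =
      ∑ π : Perm (Fin (b + 1)), (sign π : ℤ) •
        if ∀ j, j ≠ 0 → (c ∘ π) j = d j then hookPolytabloid d else 0 := by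
    intro d
    by_cases hd : Function.Injective d
    · rw [hookPolytabloid_apply, Int.cast_smul_eq_zsmul, Finset.sum_smul]
      refine Finset.sum_congr rfl fun π _ => ?_
      simp only [rowMap_eq_iff (hc.comp π.injective) hd]
      split_ifs <;> simp
    · simp [hookPolytabloid, antisymm_eq_zero_of_not_injective _ hd]
  -- Alternation in the tuple absorbs the sign of `π`.
  have h2 : ∀ (π : Perm (Fin (b + 1))) (v : V), (sign π : ℤ) •
      hookPolytabloid (Function.update (c ∘ π) 0 v) =
        hookPolytabloid (Function.update c (π 0) v) := by
    intro π v
    have : Function.update (c ∘ π) 0 v = Function.update c (π 0) v ∘ π := by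
      funext i
      by_cases h : i = 0 <;> simp [h]
    rw [this, hookPolytabloid, antisymm_comp_perm, smul_smul, Int.units_coe_mul_self, one_smul]
    rfl
  rw [Finset.sum_congr rfl fun d _ => h1 d, Finset.sum_comm]
  simp only [← Finset.smul_sum, sum_ite_agree_smul]
  simp only [Finset.smul_sum, h2]
  rw [sum_perm_fin_apply_zero (fun q => ∑ v, hookPolytabloid (Function.update c q v)),
    Finset.sum_comm]
  have h3 : ∀ v, ∑ q, hookPolytabloid (Function.update c q v) = hookPolytabloid c :=
    sum_antisymm_update _ 0 (fun c v => by rw [rowMap_update_zero]) c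
  simp only [h3, Finset.sum_const, Finset.card_univ]
  rw [smul_smul, ← Nat.cast_smul_eq_nsmul ℚ]
  push_cast
  rw [mul_comm]

/-! ### The character of the hook Specht module. -/

section Hook

variable {a b : ℕ}

theorem mem_hookDiagram {x : ℕ × ℕ} :
    x ∈ (hookDiagram a b).cells ↔ x.1 = 0 ∧ x.2 ≤ a ∨ x.2 = 0 ∧ x.1 ≤ b := by
  simp only [hookDiagram, Finset.mem_union, Finset.mem_product, Finset.mem_singleton,
    Finset.mem_range, Nat.lt_succ_iff]
  tauto

theorem card_hookDiagram_cells : (hookDiagram a b).cells.card = a + b + 1 := by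
  have h : (hookDiagram a b).cells = ({0} : Finset ℕ) ×ˢ Finset.range (a + 1) ∪
      Finset.Icc 1 b ×ˢ ({0} : Finset ℕ) := by
    ext x
    rw [mem_hookDiagram]
    simp only [Finset.mem_union, Finset.mem_product, Finset.mem_singleton, Finset.mem_range,
      Finset.mem_Icc]
    omega
  rw [h, Finset.card_union_of_disjoint]
  · simp; omega
  · rw [Finset.disjoint_left]
    simp only [Finset.mem_product, Finset.mem_singleton, Finset.mem_range, Finset.mem_Icc]
    omega

section FirstColumn

variable {V : Type*}

/-- The first column of a hook tableau. -/
def firstColumn (t : YTableau (hookDiagram a b) V) (i : Fin (b + 1)) : V :=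
  t ⟨(i, 0), mem_hookDiagram.mpr (Or.inr ⟨rfl, Nat.lt_succ_iff.mp i.2⟩)⟩

theorem firstColumn_injective (t : YTableau (hookDiagram a b) V) :
    Function.Injective (firstColumn t) := by
  intro i j h
  have := t.injective h
  simp only [Subtype.mk.injEq, Prod.mk.injEq, and_true] at this
  exact Fin.ext this

theorem colOf_firstColumn (t : YTableau (hookDiagram a b) V) (i : Fin (b + 1)) :
    t.colOf (firstColumn t i) = 0 := by
  simp [YTableau.colOf, firstColumn]

theorem exists_firstColumn_eq_of_colOf {t : YTableau (hookDiagram a b) V} {w : V}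
    (hw : t.colOf w = 0) : ∃ i, firstColumn t i = w := by
  have hle : (t.symm w).1.1 ≤ b := by
    have h := mem_hookDiagram.mp (t.symm w).2
    change (t.symm w).1.2 = 0 at hw
    omega
  refine ⟨⟨(t.symm w).1.1, Nat.lt_succ_iff.mpr hle⟩, ?_⟩
  rw [firstColumn, ← Equiv.eq_symm_apply]
  exact Subtype.ext (Prod.ext rfl hw.symm)

theorem rowOf_eq_zero_of_colOf {t : YTableau (hookDiagram a b) V} {w : V}
    (hw : t.colOf w ≠ 0) : t.rowOf w = 0 := by
  have h := mem_hookDiagram.mp (t.symm w).2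
  change (t.symm w).1.2 ≠ 0 at hw
  change (t.symm w).1.1 = 0
  omega

theorem eq_of_colOf_eq {t : YTableau (hookDiagram a b) V} {w w' : V}
    (hw : t.colOf w ≠ 0) (h : t.colOf w' = t.colOf w) : w' = w := by
  have h1 := rowOf_eq_zero_of_colOf hw
  have h2 := rowOf_eq_zero_of_colOf (h.symm ▸ hw : t.colOf w' ≠ 0)
  exact t.symm.injective (Subtype.ext (Prod.ext (h2.trans h1.symm) h))

/-- The first column of a hook tableau as an equivalence with the entries in column `0`. -/
noncomputable def firstColumnEquiv (t : YTableau (hookDiagram a b) V) :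
    Fin (b + 1) ≃ {w // t.colOf w = 0} :=
  Equiv.ofBijective (fun i => ⟨firstColumn t i, colOf_firstColumn t i⟩)
    ⟨fun _ _ h => firstColumn_injective t (congrArg Subtype.val h), fun ⟨_, hw⟩ =>
      (exists_firstColumn_eq_of_colOf hw).imp fun _ h => Subtype.ext h⟩

end FirstColumn

theorem rowOf_eq_rowMap {V : Type*} [DecidableEq V] (t : YTableau (hookDiagram a b) V) :
    t.rowOf = rowMap (firstColumn t) := by
  funext w
  by_cases hw : t.colOf w = 0
  · obtain ⟨i, rfl⟩ := exists_firstColumn_eq_of_colOf hw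
    rw [rowMap_apply (firstColumn_injective t)]
    simp [YTableau.rowOf, firstColumn]
  · rw [rowOf_eq_zero_of_colOf hw, rowMap_of_notMem]
    rintro i rfl
    exact hw (colOf_firstColumn t i)

/-- Every column but the first has a single cell, so the column stabilizer is the symmetric group of
the first column. -/
theorem polytabloid_eq (t : YTableau (hookDiagram a b) V) :
    polytabloid t = hookPolytabloid (firstColumn t) := by
  rw [polytabloid, hookPolytabloid, antisymm]
  symm
  refine Finset.sum_bij (fun π _ => π.extendDomain (firstColumnEquiv t)) ?_ ?_ ?_ ?_
  · intro π _
    simp only [Finset.mem_filter, Finset.mem_univ, true_and]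
    intro w
    by_cases hw : t.colOf w = 0
    · rw [Perm.extendDomain_apply_subtype (p := fun w => t.colOf w = 0) (h := hw), hw]
      exact (firstColumnEquiv t _).2
    · rw [Perm.extendDomain_apply_not_subtype (p := fun w => t.colOf w = 0) (h := hw)]
  · intro π _ π' _ h
    exact extendDomainHom_injective (firstColumnEquiv t) h
  · intro π hπ
    have hπ := (Finset.mem_filter.mp hπ).2
    refine ⟨(firstColumnEquiv t).symm.permCongr (π.subtypePerm fun _ => by rw [hπ]),
      Finset.mem_univ _, ?_⟩
    ext w
    by_cases hw : t.colOf w = 0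
    · rw [Perm.extendDomain_apply_subtype (p := fun w => t.colOf w = 0) (h := hw)]
      simp [permCongr_apply]
    · rw [Perm.extendDomain_apply_not_subtype (p := fun w => t.colOf w = 0) (h := hw)]
      exact (eq_of_colOf_eq hw (hπ w)).symm
  · intro π _
    rw [sign_extendDomain, rowOf_eq_rowMap, ← Int.cast_smul_eq_zsmul ℚ]
    congr 1
    have h : firstColumn t ∘ π = π.extendDomain (firstColumnEquiv t) ∘ firstColumn t := by
      funext i
      exact (Perm.extendDomain_apply_image π (firstColumnEquiv t) i).symm
    rw [h, rowMap_perm_comp]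
    simp [rowAction]

theorem exists_firstColumn_eq {V : Type*} [Fintype V] (hV : Fintype.card V = a + b + 1) {c : Fin (b + 1) → V}
    (hc : Function.Injective c) : ∃ t : YTableau (hookDiagram a b) V, firstColumn t = c := by
  have t₀ : YTableau (hookDiagram a b) V := Fintype.equivOfCardEq (by
    rw [hV, Fintype.card_coe, card_hookDiagram_cells])
  have := Equiv.Perm.isMultiplyPretransitive V (b + 1)
  obtain ⟨g, hg⟩ := MulAction.exists_smul_eq (Perm V)
    (⟨firstColumn t₀, firstColumn_injective t₀⟩ : Fin (b + 1) ↪ V) ⟨c, hc⟩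
  refine ⟨t₀.trans g, ?_⟩
  funext i
  exact DFunLike.congr_fun hg i

theorem hookPolytabloid_mem (hV : Fintype.card V = a + b + 1) (c : Fin (b + 1) → V) :
    hookPolytabloid c ∈ spechtModule (hookDiagram a b) V := by
  by_cases hc : Function.Injective c
  · obtain ⟨t, rfl⟩ := exists_firstColumn_eq hV hc
    rw [← polytabloid_eq]
    exact Submodule.subset_span ⟨t, rfl⟩
  · rw [hookPolytabloid, antisymm_eq_zero_of_not_injective _ hc]
    exact Submodule.zero_mem _

theorem sum_rowMap_smul_of_mem {x : (V → ℕ) →₀ ℚ} (hx : x ∈ spechtModule (hookDiagram a b) V) :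
    ∑ d : Fin (b + 1) → V, x (rowMap d) • hookPolytabloid d =
      (Fintype.card V * b.factorial : ℚ) • x := by
  induction hx using Submodule.span_induction with
  | mem x h =>
    obtain ⟨t, rfl⟩ := h
    simp only [polytabloid_eq]
    exact sum_rowMap_smul_hookPolytabloid (firstColumn_injective t)
  | zero => simp
  | add x y _ _ hx hy => simp only [Finsupp.add_apply, add_smul, Finset.sum_add_distrib, hx, hy,
      smul_add]
  | smul r x _ hx =>
    simp only [Finsupp.smul_apply, smul_eq_mul, mul_smul, ← Finset.smul_sum, hx]
    rw [smul_comm r, smul_comm r]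

instance finite_spechtModule (μ : YoungDiagram) : Module.Finite ℚ (spechtModule μ V) :=
  Module.Finite.span_of_finite ℚ (Set.finite_range _)

/-- The character of a hook Specht module. -/
theorem spechtCharacter_hookDiagram (hV : Fintype.card V = a + b + 1) (σ : Perm V) :
    spechtCharacter (hookDiagram a b) σ = hookChar b σ := by
  set N : ℚ := Fintype.card V * b.factorial with hN
  have hN0 : N ≠ 0 := by
    rw [hN, hV]
    positivity
  -- Applying `σ` to the reproducing formula gives a sum of rank-one maps; each has trace its
  -- functional evaluated at its vector.
  have hend : (rowAction σ).restrict (rowAction_mem_spechtModule (hookDiagram a b) σ) =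
      N⁻¹ • ∑ d : Fin (b + 1) → V,
        ((Finsupp.lapply (rowMap d)).comp (spechtModule (hookDiagram a b) V).subtype).smulRight
          (⟨hookPolytabloid (σ ∘ d), hookPolytabloid_mem hV _⟩ :
            spechtModule (hookDiagram a b) V) := by
    refine LinearMap.ext fun x => Subtype.ext ?_
    have h := congrArg (rowAction σ) (sum_rowMap_smul_of_mem x.2)
    rw [map_smul, ← hN] at h
    simp only [LinearMap.coe_restrict_apply, LinearMap.smul_apply, LinearMap.sum_apply,
      LinearMap.smulRight_apply, LinearMap.comp_apply, Submodule.subtype_apply,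
      Finsupp.lapply_apply, Submodule.coe_smul, Submodule.coe_sum]
    rw [eq_inv_smul_iff₀ hN0, ← h, map_sum]
    simp only [map_smul, rowAction_hookPolytabloid]
  have hcount : ∀ d : Fin (b + 1) → V, hookPolytabloid (σ ∘ d) (rowMap d) =
      ((∑ π : Perm (Fin (b + 1)), (sign π : ℤ) *
        if ∀ j, j ≠ 0 → σ (d (π j)) = d j then 1 else 0 : ℤ) : ℚ) := by
    intro d
    by_cases hd : Function.Injective d
    · rw [hookPolytabloid_apply]
      simp only [rowMap_eq_iff ((σ.injective.comp hd).comp (Equiv.injective _)) hd]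
      rfl
    · rw [hookPolytabloid, antisymm_eq_zero_of_not_injective _ fun h => hd h.of_comp]
      symm
      rw [Finsupp.zero_apply, Int.cast_eq_zero]
      convert! sum_perm_eq_zero_of_not_injective (fun j => j ≠ 0) σ hd
  rw [spechtCharacter, hend, map_smul, map_sum]
  simp only [LinearMap.trace_smulRight, LinearMap.comp_apply, Submodule.subtype_apply,
    Finsupp.lapply_apply, hcount]
  rw [← Int.cast_sum, smul_eq_mul, inv_mul_eq_iff_eq_mul₀ hN0, hN]
  trans ((pointedCount σ (0 : Fin (b + 1)) : ℤ) : ℚ)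
  · rw [pointedCount]
    congr!
  · rw [pointedCount_eq b σ 0 (by simp)]
    push_cast
    rfl

end Hook

/-! ### Splitting off the cycle through a vertex. -/

/-- `f` permutes `S` cyclically, fixes everything else, and `v` belongs to `S`. -/
structure IsCycleThrough {V : Type*} (f : Perm V) (S : Finset V) (v : V) : Prop where
  mem : v ∈ S
  fix : ∀ w, w ∉ S → f w = w
  sameCycle : ∀ w ∈ S, f.SameCycle v w

namespace IsCycleThrough

variable {V : Type*} [Fintype V] [DecidableEq V] {f : Perm V} {S : Finset V} {v : V}

theorem apply_mem_iff {V : Type*} {f : Perm V} {S : Finset V} {v : V} (h : IsCycleThrough f S v) (w : V) : f w ∈ S ↔ w ∈ S := by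
  by_cases hw : w ∈ S
  · refine iff_of_true (by_contra fun hn => ?_) hw
    exact hn (by rwa [f.injective (h.fix _ hn)])
  · rw [h.fix w hw]

theorem sign_eq (h : IsCycleThrough f S v) : (sign f : ℤ) = -(-1) ^ S.card := by
  -- A fixed point counts as a cycle with `S = {v}` and `f = 1`; this is how the diagonal term
  -- enters the expansion.
  by_cases hv : f v = v
  · have hS : ∀ w ∈ S, w = v := fun w hw => ((h.sameCycle w hw).eq_of_left hv).symm
    have hf : f = 1 := by
      ext w
      by_cases hw : w ∈ S
      · rw [hS w hw, hv, Perm.one_apply]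
      · rw [h.fix w hw, Perm.one_apply]
    rw [Finset.eq_singleton_iff_unique_mem.mpr ⟨h.mem, hS⟩, hf]
    simp
  · have hc : f.IsCycle := ⟨v, hv, fun y hy => h.sameCycle y (by_contra fun hn => hy (h.fix y hn))⟩
    have hs : f.support = S := by
      ext w
      rw [mem_support]
      refine ⟨fun hw => by_contra fun hn => hw (h.fix w hn), fun hw he => hv ?_⟩
      rw [((h.sameCycle w hw).symm.eq_of_left he).symm, he]
    rw [hc.sign, hs]
    simp

theorem mul_ofSubtype_apply_of_mem {V : Type*} [DecidableEq V] {f : Perm V} {S : Finset V}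
    {v : V} (_h : IsCycleThrough f S v) (τ : Perm {w // w ∉ S}) {w : V}
    (hw : w ∈ S) : (f * ofSubtype τ) w = f w := by
  rw [Perm.mul_apply, ofSubtype_apply_of_not_mem (p := fun w => w ∉ S) _ (not_not.mpr hw)]

theorem mul_ofSubtype_apply_coe {V : Type*} [DecidableEq V] {f : Perm V} {S : Finset V}
    {v : V} (h : IsCycleThrough f S v) (τ : Perm {w // w ∉ S})
    (w : {w // w ∉ S}) : (f * ofSubtype τ) w = τ w := by
  rw [Perm.mul_apply, ofSubtype_apply_coe, h.fix _ (τ w).2]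

theorem cycleOf_mul_ofSubtype (h : IsCycleThrough f S v) (τ : Perm {w // w ∉ S}) :
    (f * ofSubtype τ).cycleOf v = f := by
  have hd : f.Disjoint (ofSubtype τ) := fun w => by
    by_cases hw : w ∈ S
    · exact Or.inr (ofSubtype_apply_of_not_mem _ (not_not.mpr hw))
    · exact Or.inl (h.fix w hw)
  rw [cycleOf_mul_of_apply_right_eq_self hd.commute v
    (ofSubtype_apply_of_not_mem _ (not_not.mpr h.mem))]
  ext w
  rw [cycleOf_apply]
  split_ifs with hw
  · rfl
  · exact (h.fix w fun hS => hw (h.sameCycle w hS)).symm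

theorem exists_eq_mul_ofSubtype (h : IsCycleThrough f S v) {σ : Perm V} (hσ : σ.cycleOf v = f) :
    ∃ τ : Perm {w // w ∉ S}, f * ofSubtype τ = σ := by
  have hS : ∀ w ∈ S, f w = σ w := fun w hw => by
    obtain ⟨m, rfl⟩ := h.sameCycle w hw
    rw [← hσ, cycleOf_zpow_apply_self]
    exact SameCycle.cycleOf_apply ⟨m, rfl⟩
  have hmem : ∀ w, σ w ∈ S ↔ w ∈ S := fun w => by
    by_cases hw : w ∈ S
    · rw [← hS w hw]
      exact h.apply_mem_iff w
    · refine iff_of_false (fun hn => hw ?_) hw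
      obtain ⟨w', hw'⟩ := f.surjective (σ w)
      have hw'S : w' ∈ S := by rw [← h.apply_mem_iff, hw']; exact hn
      rw [hS w' hw'S] at hw'
      rwa [← σ.injective hw']
  refine ⟨σ.subtypePerm fun w => not_congr (hmem w), ?_⟩
  ext w
  by_cases hw : w ∈ S
  · rw [h.mul_ofSubtype_apply_of_mem _ hw, hS w hw]
  · exact h.mul_ofSubtype_apply_coe _ ⟨w, hw⟩

/-- Once the cycle through `v` is prescribed, the rest of `σ` is an arbitrary permutation of the
complement of `S`. -/
theorem sum_cycleOf_eq {A : Type*} [AddCommMonoid A] (h : IsCycleThrough f S v)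
    (F : Perm V → A) :
    ∑ σ with σ.cycleOf v = f, F σ = ∑ τ : Perm {w // w ∉ S}, F (f * ofSubtype τ) := by
  symm
  refine Finset.sum_bij (fun τ _ => f * ofSubtype τ) ?_ ?_ ?_ ?_
  · intro τ _
    simpa using h.cycleOf_mul_ofSubtype τ
  · intro τ _ τ' _ he
    exact ofSubtype_injective (mul_left_cancel he)
  · intro σ hσ
    obtain ⟨τ, hτ⟩ := h.exists_eq_mul_ofSubtype (Finset.mem_filter.mp hσ).2
    exact ⟨τ, Finset.mem_univ _, hτ⟩
  · intro τ _
    rfl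

theorem invariantSign_map (h : IsCycleThrough f S v) (τ : Perm {w // w ∉ S})
    (T : Finset {w // w ∉ S}) :
    invariantSign (f * ofSubtype τ) (T.map (Function.Embedding.subtype _)) =
      invariantSign τ T := by
  have hT : (∀ x, (f * ofSubtype τ) x ∈ T.map (Function.Embedding.subtype _) ↔
      x ∈ T.map (Function.Embedding.subtype _)) ↔ ∀ x, τ x ∈ T ↔ x ∈ T := by
    constructor
    · intro hx x
      simpa [-Perm.coe_mul, h.mul_ofSubtype_apply_coe, (τ x).2, x.2] using hx x
    · intro hx x
      by_cases hxS : x ∈ S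
      · have := (h.apply_mem_iff x).mpr hxS
        rw [h.mul_ofSubtype_apply_of_mem τ hxS]
        simp [hxS, this]
      · rw [h.mul_ofSubtype_apply_coe τ ⟨x, hxS⟩]
        simpa [hxS, (τ ⟨x, hxS⟩).2] using hx ⟨x, hxS⟩
  unfold invariantSign
  by_cases hinv : ∀ x, τ x ∈ T ↔ x ∈ T
  · rw [dif_pos (hT.mpr hinv), dif_pos hinv]
    let e : {x // x ∈ T} ≃ {x // x ∈ T.map (Function.Embedding.subtype _)} :=
      Equiv.ofBijective (fun x => ⟨x.1.1, Finset.mem_map_of_mem _ x.2⟩)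
        ⟨fun x y hxy => Subtype.ext (Subtype.ext (Subtype.mk.inj hxy)), fun ⟨x, hx⟩ => by
          obtain ⟨y, hy, rfl⟩ := Finset.mem_map.mp hx
          exact ⟨⟨y, hy⟩, rfl⟩⟩
    symm
    refine congrArg _ (sign_eq_sign_of_equiv _ _ e fun x => Subtype.ext ?_)
    exact (h.mul_ofSubtype_apply_coe τ x.1).symm
  · rw [dif_neg (mt hT.mp hinv), dif_neg hinv]

theorem invariantSign_union (h : IsCycleThrough f S v) (τ : Perm {w // w ∉ S})
    (T : Finset {w // w ∉ S}) :
    invariantSign (f * ofSubtype τ) (S ∪ T.map (Function.Embedding.subtype _)) =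
      sign f * invariantSign τ T := by
  have hT : (∀ x, (f * ofSubtype τ) x ∈ S ∪ T.map (Function.Embedding.subtype _) ↔
      x ∈ S ∪ T.map (Function.Embedding.subtype _)) ↔ ∀ x, τ x ∈ T ↔ x ∈ T := by
    constructor
    · intro hx x
      simpa [-Perm.coe_mul, h.mul_ofSubtype_apply_coe, (τ x).2, x.2] using hx x
    · intro hx x
      by_cases hxS : x ∈ S
      · have := (h.apply_mem_iff x).mpr hxS
        rw [h.mul_ofSubtype_apply_of_mem τ hxS]
        simp [hxS, this]
      · rw [h.mul_ofSubtype_apply_coe τ ⟨x, hxS⟩]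
        simpa [hxS, (τ ⟨x, hxS⟩).2] using hx ⟨x, hxS⟩
  unfold invariantSign
  by_cases hinv : ∀ x, τ x ∈ T ↔ x ∈ T
  · rw [dif_pos (hT.mpr hinv), dif_pos hinv]
    let e : {x // x ∈ S} ⊕ {x // x ∈ T} ≃
        {x // x ∈ S ∪ T.map (Function.Embedding.subtype _)} :=
      Equiv.ofBijective (Sum.elim
        (fun x => ⟨x.1, Finset.mem_union_left _ x.2⟩)
        (fun x => ⟨x.1.1, Finset.mem_union_right _ (Finset.mem_map_of_mem _ x.2)⟩)) <| by
        constructor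
        · rintro (x | x) (y | y) hxy
          · exact congrArg Sum.inl (Subtype.ext (Subtype.mk.inj hxy))
          · exact absurd x.2 ((Subtype.mk.inj hxy : x.1 = y.1.1) ▸ y.1.2)
          · exact absurd y.2 ((Subtype.mk.inj hxy : x.1.1 = y.1) ▸ x.1.2)
          · exact congrArg Sum.inr (Subtype.ext (Subtype.ext (Subtype.mk.inj hxy)))
        · rintro ⟨x, hx⟩
          rcases Finset.mem_union.mp hx with hx | hx
          · exact ⟨Sum.inl ⟨x, hx⟩, rfl⟩
          · obtain ⟨y, hy, rfl⟩ := Finset.mem_map.mp hx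
            exact ⟨Sum.inr ⟨y, hy⟩, rfl⟩
    have hs := sign_eq_sign_of_equiv
      (Perm.sumCongr (f.subtypePerm h.apply_mem_iff) (τ.subtypePerm hinv))
      ((f * ofSubtype τ).subtypePerm (hT.mpr hinv)) e (by
        rintro (x | x)
        · exact Subtype.ext (h.mul_ofSubtype_apply_of_mem τ x.2).symm
        · exact Subtype.ext (h.mul_ofSubtype_apply_coe τ x.1).symm)
    have hf : sign (f.subtypePerm (p := fun w => w ∈ S) h.apply_mem_iff) = sign f := by
      convert! sign_subtypePerm f h.apply_mem_iff fun x hx => by_contra fun hn => hx (h.fix x hn)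
    rw [← hs, sign_sumCongr, hf, Units.val_mul]
  · rw [dif_neg (mt hT.mp hinv), dif_neg hinv, mul_zero]

/-- An invariant set is a union of orbits, so it cannot split `S`. -/
theorem invariantSign_eq_zero (h : IsCycleThrough f S v) (τ : Perm {w // w ∉ S}) {U : Finset V}
    (hU : ∃ w ∈ S, ¬ (w ∈ U ↔ v ∈ U)) : invariantSign (f * ofSubtype τ) U = 0 := by
  refine dif_neg fun hinv => ?_
  obtain ⟨w, hwS, hw⟩ := hU
  refine hw ?_
  have hs : (f * ofSubtype τ).SameCycle v w := by
    by_contra hn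
    have h1 := h.cycleOf_mul_ofSubtype τ
    have h2 := cycleOf_apply_of_not_sameCycle hn
    rw [h1] at h2
    exact hn ((h.sameCycle w hwS).symm.eq_of_left h2 ▸ SameCycle.refl _ _)
  have hz : ∀ (n : ℕ) (x : V), ((f * ofSubtype τ) ^ n) x ∈ U ↔ x ∈ U := fun n => by
    induction n with
    | zero => simp
    | succ n ih => intro x; rw [pow_succ', Perm.mul_apply, hinv, ih]
  obtain ⟨n, -, hn⟩ := SameCycle.exists_pow_eq' hs
  exact hn ▸ hz n v

theorem sum_finset_eq {A : Type*} [AddCommMonoid A] (h : IsCycleThrough f S v)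
    (F : Finset V → A) (hF : ∀ U, (∃ w ∈ S, ¬ (w ∈ U ↔ v ∈ U)) → F U = 0) :
    ∑ U, F U = (∑ T : Finset {w // w ∉ S}, F (T.map (Function.Embedding.subtype _))) +
      ∑ T : Finset {w // w ∉ S}, F (S ∪ T.map (Function.Embedding.subtype _)) := by
  rw [← Finset.sum_filter_add_sum_filter_not Finset.univ fun U => v ∉ U]
  congr 1
  · symm
    refine Finset.sum_of_injOn (fun T => T.map (Function.Embedding.subtype _))
      (fun T _ T' _ hT => Finset.map_injective _ hT) ?_ ?_ fun _ _ => rfl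
    · intro T _
      simp [h.mem]
    · intro U hU hT
      refine hF U (by_contra fun hn => hT ?_)
      push Not at hn
      have hvU : v ∉ U := (Finset.mem_filter.mp hU).2
      refine ⟨U.subtype fun w => w ∉ S, Finset.mem_coe.mpr (Finset.mem_univ _), ?_⟩
      ext w
      simp only [Finset.subtype_map, Finset.mem_filter, and_iff_left_iff_imp]
      exact fun hw hS => hvU ((hn w hS).mp hw)
  · symm
    refine Finset.sum_of_injOn (fun T => S ∪ T.map (Function.Embedding.subtype _))
      (fun T _ T' _ hT => ?_) ?_ ?_ fun _ _ => rfl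
    · ext x
      have := Finset.ext_iff.mp hT x
      simpa [x.2] using this
    · intro T _
      simp [h.mem]
    · intro U hU hT
      refine hF U (by_contra fun hn => hT ?_)
      push Not at hn
      have hvU : v ∈ U := not_not.mp (Finset.mem_filter.mp hU).2
      refine ⟨U.subtype fun w => w ∉ S, Finset.mem_coe.mpr (Finset.mem_univ _), ?_⟩
      ext w
      simp only [Finset.subtype_map, Finset.mem_filter, Finset.mem_union]
      by_cases hw : w ∈ S
      · simp [hw, (hn w hw).mpr hvU]
      · simp [hw]

/-- The Murnaghan–Nakayama rule for hooks. -/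
theorem hookChar_mul_ofSubtype (h : IsCycleThrough f S v) (b : ℤ) (τ : Perm {w // w ∉ S}) :
    hookChar b (f * ofSubtype τ) = hookChar b τ - (-1) ^ S.card * hookChar (b - S.card) τ := by
  rw [hookChar, h.sum_finset_eq, sub_eq_add_neg, ← neg_mul, ← h.sign_eq, hookChar, hookChar,
    Finset.mul_sum]
  · congr 1
    · refine Finset.sum_congr rfl fun T _ => ?_
      rw [h.invariantSign_map, Finset.card_map]
    · refine Finset.sum_congr rfl fun T _ => ?_
      have hcard : ((S ∪ T.map (Function.Embedding.subtype _)).card : ℤ) = S.card + T.card := by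
        rw [Finset.card_union_of_disjoint, Finset.card_map, Nat.cast_add]
        rw [Finset.disjoint_left]
        intro w hw hT
        obtain ⟨y, -, rfl⟩ := Finset.mem_map.mp hT
        exact y.2 hw
      rw [h.invariantSign_union, hcard, mul_ite, mul_zero, sub_add_eq_sub_sub]
      refine if_congr (by omega) ?_ rfl
      ring
  · intro U hU
    rw [h.invariantSign_eq_zero τ hU, mul_zero, ite_self]

end IsCycleThrough

/-! ### Cycle expansion of hook immanants. -/

variable {V : Type*} [Fintype V] [DecidableEq V] {R : Type*} [CommRing R] [Algebra ℚ R]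

/-- One formula covers all conventions: with `b = n - k`, the character vanishes for `k > n` (`b <
0`) and, when `n ≥ 1`, for `k < 1` (`b ≥ n`), while `n = 0` gives `(-1)^k` for `k ≤ 0`. -/
theorem hookImmanant_eq_sum (k : ℤ) (M : Matrix V V R) :
    hookImmanant k M =
      ∑ σ : Perm V, (hookChar (Fintype.card V - k) σ : R) * ∏ i, M i (σ i) := by
  unfold hookImmanant
  split_ifs with h0 hk hk
  · have : IsEmpty V := Fintype.card_eq_zero_iff.mp h0
    rw [Fintype.sum_unique, hookChar, Fintype.sum_unique, h0]
    have : invariantSign (default : Perm V) (default : Finset V) = 1 := by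
      rw [invariantSign, dif_pos fun x => isEmptyElim x, Subsingleton.elim (subtypePerm _ _) 1]
      simp
    rw [this]
    simp [Finset.eq_empty_of_isEmpty, hk]
  · have : IsEmpty V := Fintype.card_eq_zero_iff.mp h0
    rw [Fintype.sum_unique, hookChar_of_neg (by rw [h0]; push_cast; omega)]
    simp
  · refine Finset.sum_congr rfl fun σ _ => ?_
    rw [spechtCharacter_hookDiagram (by omega), Algebra.smul_def, map_intCast,
      Int.toNat_of_nonneg (by omega)]
  · have : Nonempty V := Fintype.card_pos_iff.mp (Nat.pos_of_ne_zero h0)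
    refine (Finset.sum_eq_zero fun σ _ => ?_).symm
    have : hookChar (Fintype.card V - k) σ = 0 := by
      by_cases h1 : 1 ≤ k
      · exact hookChar_of_neg (by omega) σ
      · exact hookChar_eq_zero_of_card_le (by omega) σ
    rw [this, Int.cast_zero, zero_mul]

theorem IsCycleThrough.sum_hookChar_mul_prod {f : Perm V} {S : Finset V} {v : V}
    (h : IsCycleThrough f S v) (k : ℤ) (M : Matrix V V R) :
    ∑ σ with σ.cycleOf v = f, (hookChar (Fintype.card V - k) σ : R) * ∏ i, M i (σ i) =
      (∏ i ∈ S, M i (f i)) *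
        (hookImmanant (k - S.card)
            (M.submatrix (Subtype.val : {w // w ∉ S} → V) Subtype.val) -
          (-1) ^ S.card *
            hookImmanant k (M.submatrix (Subtype.val : {w // w ∉ S} → V) Subtype.val)) := by
  rw [h.sum_cycleOf_eq, hookImmanant_eq_sum, hookImmanant_eq_sum, Finset.mul_sum,
    ← Finset.sum_sub_distrib, Finset.mul_sum]
  refine Finset.sum_congr rfl fun τ _ => ?_
  have hprod : ∏ i, M i ((f * ofSubtype τ) i) =
      (∏ i ∈ S, M i (f i)) * ∏ i : {w // w ∉ S}, M i (τ i) := by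
    rw [← Finset.prod_mul_prod_compl S]
    congr 1
    · exact Finset.prod_congr rfl fun i hi => by rw [h.mul_ofSubtype_apply_of_mem τ hi]
    · rw [Finset.prod_subtype Sᶜ (p := fun w => w ∉ S) (by simp)]
      exact Finset.prod_congr rfl fun i _ => by rw [h.mul_ofSubtype_apply_coe]
  have hcard : (Fintype.card {w // w ∉ S} : ℤ) = Fintype.card V - S.card := by
    rw [Fintype.card_subtype_compl, Fintype.card_coe, Nat.cast_sub (Finset.card_le_univ S)]
  rw [hprod, h.hookChar_mul_ofSubtype, hcard]
  -- On `n - |S|` points, leg length `b` means index `k - |S|`, and leg length `b - |S|` means index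
  -- `k`.
  have e1 : (Fintype.card V : ℤ) - S.card - (k - S.card) = Fintype.card V - k := by ring
  have e2 : (Fintype.card V : ℤ) - S.card - k = Fintype.card V - k - S.card := by ring
  rw [e1, e2]
  simp only [Matrix.submatrix_apply]
  push_cast
  ring

theorem isCycleThrough_one {V : Type*} (v : V) : IsCycleThrough (1 : Perm V) {v} v where
  mem := Finset.mem_singleton_self v
  fix _ _ := rfl
  sameCycle w hw := by rw [Finset.mem_singleton.mp hw]

theorem mem_cycleVerts {V : Type*} [DecidableEq V] {c : VertexCycle V} {w : V} : w ∈ cycleVerts c ↔ w ∈ c.1 := by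
  obtain ⟨⟨l⟩, hc⟩ := c
  simp [cycleVerts]

theorem isCycleThrough_formPerm (c : VertexCycle V) {v : V} (hv : v ∈ c.1) :
    IsCycleThrough (c.1.formPerm c.2.1) (cycleVerts c) v := by
  have hs : (c.1.formPerm c.2.1).support = cycleVerts c :=
    Cycle.support_formPerm c.1 c.2.1 c.2.2
  have hmem : ∀ {w}, w ∈ cycleVerts c → (c.1.formPerm c.2.1) w ≠ w := fun hw =>
    mem_support.mp (hs ▸ hw)
  refine ⟨mem_cycleVerts.mpr hv, fun w hw => notMem_support.mp (hs ▸ hw), fun w hw => ?_⟩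
  exact (Cycle.isCycle_formPerm c.1 c.2.1 c.2.2).sameCycle (hmem (mem_cycleVerts.mpr hv)) (hmem hw)

open Classical in
/-- Expansion of a hook immanant along the cycles through `v`. -/
theorem hookImmanant_expand (k : ℤ) (M : Matrix V V R) (v : V) :
    hookImmanant k M =
      M v v * (hookImmanant (k - 1)
            (M.submatrix (Subtype.val : {w // w ∉ ({v} : Finset V)} → V) Subtype.val) +
          hookImmanant k
            (M.submatrix (Subtype.val : {w // w ∉ ({v} : Finset V)} → V) Subtype.val)) +
        ∑ c : VertexCycle V with v ∈ c.1, (∏ i ∈ cycleVerts c, M i (c.1.formPerm c.2.1 i)) *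
          (hookImmanant (k - (cycleVerts c).card)
              (M.submatrix (Subtype.val : {w // w ∉ cycleVerts c} → V) Subtype.val) -
            (-1) ^ (cycleVerts c).card * hookImmanant k
              (M.submatrix (Subtype.val : {w // w ∉ cycleVerts c} → V) Subtype.val)) := by
  have hinj : Function.Injective fun c : VertexCycle V => c.1.formPerm c.2.1 := fun c c' hc =>
    isoCycle.symm.injective (Subtype.ext hc)
  rw [hookImmanant_eq_sum, ← Finset.sum_filter_add_sum_filter_not Finset.univ fun σ => σ v = v]
  congr 1
  · have h1 := (isCycleThrough_one v).sum_hookChar_mul_prod k M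
    simp only [cycleOf_eq_one_iff] at h1
    rw [h1]
    simp
  -- Permutations moving `v` are sorted by their cycle through `v`; `isoCycle` matches these cycles
  -- with cyclic sequences.
  · rw [← Finset.sum_fiberwise_of_maps_to (g := fun σ : Perm V => σ.cycleOf v)
      (t := (Finset.univ.filter fun c : VertexCycle V => v ∈ c.1).image
        fun c => c.1.formPerm c.2.1), Finset.sum_image hinj.injOn]
    · refine Finset.sum_congr rfl fun c hc => ?_
      have hv : v ∈ c.1 := (Finset.mem_filter.mp hc).2
      rw [← (isCycleThrough_formPerm c hv).sum_hookChar_mul_prod, Finset.filter_filter]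
      refine Finset.sum_congr (Finset.filter_congr fun σ _ => ?_) fun _ _ => rfl
      refine and_iff_right_of_imp fun hσ hf => ?_
      rw [(cycleOf_eq_one_iff σ).mpr hf] at hσ
      exact (Cycle.isCycle_formPerm c.1 c.2.1 c.2.2).ne_one hσ.symm
    · intro σ hσ
      have hσ : σ v ≠ v := (Finset.mem_filter.mp hσ).2
      let c : VertexCycle V := isoCycle ⟨σ.cycleOf v, isCycle_cycleOf σ hσ⟩
      have hc : c.1.formPerm c.2.1 = σ.cycleOf v :=
        congrArg Subtype.val (isoCycle.symm_apply_apply ⟨σ.cycleOf v, isCycle_cycleOf σ hσ⟩)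
      refine Finset.mem_image.mpr ⟨c, Finset.mem_filter.mpr ⟨Finset.mem_univ _, ?_⟩, hc⟩
      by_contra hv
      have := Cycle.formPerm_eq_self_of_notMem c.1 c.2.1 v hv
      rw [hc, cycleOf_apply_self] at this
      exact hσ this

theorem cycle_chain_iff_next {V : Type*} [DecidableEq V] {r : V → V → Prop} (c : Cycle V)
    (hc : c.Nodup) : c.Chain r ↔ ∀ w (hw : w ∈ c), r w (c.next hc w hw) := by
  induction c using Quotient.inductionOn' with | _ l => ?_
  rcases l with - | ⟨a, l⟩
  · simp only [Cycle.mk''_eq_coe, Cycle.coe_nil]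
    exact iff_of_true trivial fun w hw => absurd hw (Cycle.notMem_nil w)
  · have hn : (a :: l).Nodup := hc
    have hnext : ∀ (i : ℕ) (hi : i < (a :: l).length),
        (a :: l).next (a :: l)[i] (List.getElem_mem hi) =
          (a :: (l ++ [a]))[i + 1]'(by simp at hi ⊢; omega) := by
      intro i hi
      rw [List.next_getElem _ hn i hi]
      by_cases h : i + 1 < (a :: l).length
      · simp only [Nat.mod_eq_of_lt h, List.getElem_cons_succ]
        rw [List.getElem_append_left]
      · have : i = l.length := by simp at hi h; omega
        subst this
        simp
    have hget : ∀ (i : ℕ) (hi : i < (a :: l).length),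
        (a :: (l ++ [a]))[i]'(by simp at hi ⊢; omega) = (a :: l)[i] := fun i hi =>
      List.getElem_append_left (as := a :: l) (bs := [a]) hi
    change Cycle.Chain r ((a :: l : List V) : Cycle V) ↔ _
    rw [Cycle.chain_coe_cons, List.isChain_iff_getElem]
    constructor
    · intro h w hw
      obtain ⟨i, hi, rfl⟩ := List.getElem_of_mem (Cycle.mem_coe_iff.mp hw)
      have := h i (by simp at hi ⊢; omega)
      rwa [← hnext i hi, hget i hi] at this
    · intro h i hi
      have hi' : i < (a :: l).length := by simp at hi ⊢; omega
      have := h _ (Cycle.mem_coe_iff.mpr (List.getElem_mem hi'))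
      rwa [← hnext i hi', hget i hi']

theorem cycle_chain_iff {V : Type*} [DecidableEq V] {r : V → V → Prop} (c : VertexCycle V) :
    c.1.Chain r ↔ ∀ w ∈ c.1, r w (c.1.formPerm c.2.1 w) := by
  rw [cycle_chain_iff_next c.1 c.2.1]
  refine forall₂_congr fun w hw => ?_
  rw [Cycle.formPerm_apply_mem_eq_next _ c.2.1 w hw]

theorem formPerm_apply_ne {V : Type*} [Fintype V] [DecidableEq V] (c : VertexCycle V) {w : V}
    (hw : w ∈ c.1) : c.1.formPerm c.2.1 w ≠ w := by
  have h : w ∈ (c.1.formPerm c.2.1).support := by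
    rw [Cycle.support_formPerm c.1 c.2.1 c.2.2]
    exact mem_cycleVerts.mpr hw
  exact mem_support.mp h

theorem charmatrix_submatrix_subtype {V : Type*} [Fintype V] [DecidableEq V] {p : V → Prop}
    [DecidablePred p] (M : Matrix V V ℝ) :
    M.charmatrix.submatrix (Subtype.val : {w // p w} → V) Subtype.val =
      (M.submatrix (Subtype.val : {w // p w} → V) Subtype.val).charmatrix := by
  ext i j : 2
  by_cases h : i = j
  · simp [h]
  · rw [Matrix.submatrix_apply, Matrix.charmatrix_apply_ne _ _ _ h,
      Matrix.charmatrix_apply_ne _ _ _ fun h' => h (Subtype.ext h'), Matrix.submatrix_apply]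

/-! ### Digraph matrices and deletion of an arc. -/

section Digraph

variable {V : Type*} [Fintype V] [DecidableEq V] {G : Digraph V} {β γ : ℝ}

open Classical in
theorem digraphH_apply_ne {i j : V} (h : i ≠ j) :
    digraphH β γ G i j = if G.Adj i j then γ else 0 := by
  simp [digraphH, outDegMatrix, digraphAdjMatrix, h]

theorem digraphH_apply_self (hloop : ∀ w, ¬ G.Adj w w) (v : V) :
    digraphH β γ G v v = β * outDeg G v := by
  simp [digraphH, outDegMatrix, digraphAdjMatrix, hloop]

theorem prod_charmatrix_of_chain {c : VertexCycle V} (hc : c.1.Chain G.Adj) :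
    ∏ i ∈ cycleVerts c, (digraphH β γ G).charmatrix i (c.1.formPerm c.2.1 i) =
      (-1) ^ (cycleVerts c).card * Polynomial.C (γ ^ (cycleVerts c).card) := by
  rw [Finset.prod_congr rfl (g := fun _ => -Polynomial.C γ), Finset.prod_const, neg_pow, map_pow]
  intro i hi
  have hi := mem_cycleVerts.mp hi
  have hne := (formPerm_apply_ne c hi).symm
  rw [Matrix.charmatrix_apply_ne _ _ _ hne, digraphH_apply_ne hne,
    if_pos ((cycle_chain_iff c).mp hc i hi)]

theorem prod_charmatrix_of_not_chain {c : VertexCycle V} (hc : ¬ c.1.Chain G.Adj) :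
    ∏ i ∈ cycleVerts c, (digraphH β γ G).charmatrix i (c.1.formPerm c.2.1 i) = 0 := by
  rw [cycle_chain_iff] at hc
  push Not at hc
  obtain ⟨i, hi, hadj⟩ := hc
  have hne := (formPerm_apply_ne c hi).symm
  refine Finset.prod_eq_zero (mem_cycleVerts.mpr hi) ?_
  rw [Matrix.charmatrix_apply_ne _ _ _ hne, digraphH_apply_ne hne, if_neg hadj]
  simp

-- A directed cycle of length `l` contributes `(-γ)^l`; its sign moves to the first polynomial and
-- cancels the factor `(-1)^l` of the second.
open Classical in
theorem prod_charmatrix_mul_eq_ite (k : ℤ) (c : VertexCycle V) :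
    (∏ i ∈ cycleVerts c, (digraphH β γ G).charmatrix i (c.1.formPerm c.2.1 i)) *
        (hookPoly (k - (cycleVerts c).card) (digraphHDel β γ G (cycleVerts c)) -
          (-1) ^ (cycleVerts c).card * hookPoly k (digraphHDel β γ G (cycleVerts c))) =
      if c.1.Chain G.Adj then cycleTerm β γ G k c else 0 := by
  split_ifs with hc
  · rw [prod_charmatrix_of_chain hc, cycleTerm]
    have h1 : ((-1 : ℝ[X]) ^ (cycleVerts c).card) * (-1) ^ (cycleVerts c).card = 1 := by
      rw [← mul_pow]
      simp
    linear_combination (-(Polynomial.C (γ ^ (cycleVerts c).card) *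
      hookPoly k (digraphHDel β γ G (cycleVerts c)))) * h1
  · rw [prod_charmatrix_of_not_chain hc, zero_mul]

theorem hookPoly_vertex_expansion (hloop : ∀ w, ¬ G.Adj w w) (k : ℤ) (v : V) :
    hookPoly k (digraphH β γ G) =
      (Polynomial.X - Polynomial.C (β * (outDeg G v : ℝ))) *
          (hookPoly (k - 1) (digraphHDel β γ G {v}) + hookPoly k (digraphHDel β γ G {v})) +
        ∑ c ∈ cyclesThroughVertex G v, cycleTerm β γ G k c := by
  classical
  have h := hookImmanant_expand k (digraphH β γ G).charmatrix v
  simp only [charmatrix_submatrix_subtype] at h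
  rw [Matrix.charmatrix_apply_eq, digraphH_apply_self hloop] at h
  refine h.trans (congrArg₂ _ rfl ?_)
  refine (Finset.sum_congr rfl fun c _ => prod_charmatrix_mul_eq_ite k c).trans ?_
  rw [← Finset.sum_filter, Finset.filter_filter, cyclesThroughVertex, directedCycles,
    Finset.filter_filter]
  refine Finset.sum_congr ?_ fun _ _ => rfl
  ext c
  simp only [Finset.mem_filter, and_comm]

variable {v u : V}

theorem outDeg_deleteArc_of_ne {V : Type*} [Fintype V] {G : Digraph V} {v u w : V} (hw : w ≠ v) : outDeg (deleteArc G v u) w = outDeg G w := by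
  classical
  rw [outDeg, outDeg]
  congr 1
  ext x
  rw [Finset.mem_filter, Finset.mem_filter]
  simp [deleteArc, hw]

theorem outDeg_eq_deleteArc_add_one (h : G.Adj v u) :
    outDeg G v = outDeg (deleteArc G v u) v + 1 := by
  classical
  rw [outDeg, outDeg, ← Finset.card_insert_of_notMem (a := u)]
  · congr 1
    ext w
    by_cases hw : w = u <;> simp [deleteArc, hw, h]
  · simp [deleteArc]

/-- Deleting the arc alters only row `v` of `H`, and that row is removed. -/
theorem digraphHDel_deleteArc {S : Finset V} (hv : v ∈ S) :
    digraphHDel β γ (deleteArc G v u) S = digraphHDel β γ G S := by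
  classical
  ext i j
  have hi : (i : V) ≠ v := fun h => i.2 (h ▸ hv)
  have hadj : (deleteArc G v u).Adj i j ↔ G.Adj i j := by simp [deleteArc, hi]
  simp [digraphHDel, digraphH, outDegMatrix, digraphAdjMatrix, Matrix.diagonal_apply,
    outDeg_deleteArc_of_ne hi]
  exact if_congr hadj rfl rfl

theorem cycleTerm_deleteArc (k : ℤ) {c : VertexCycle V} (hv : v ∈ c.1) :
    cycleTerm β γ (deleteArc G v u) k c = cycleTerm β γ G k c := by
  rw [cycleTerm, cycleTerm, digraphHDel_deleteArc (mem_cycleVerts.mpr hv)]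

theorem chain_deleteArc_iff {V : Type*} [DecidableEq V] {G : Digraph V} {v u : V} {c : VertexCycle V} (hv : v ∈ c.1) :
    c.1.Chain (deleteArc G v u).Adj ↔ c.1.Chain G.Adj ∧ c.1.next c.2.1 v hv ≠ u := by
  rw [cycle_chain_iff, cycle_chain_iff, ← Cycle.formPerm_apply_mem_eq_next c.1 c.2.1 v hv]
  constructor
  · exact fun h => ⟨fun w hw => (h w hw).1, fun hu => (h v hv).2 ⟨rfl, hu⟩⟩
  · rintro ⟨h, hu⟩ w hw
    refine ⟨h w hw, ?_⟩
    rintro ⟨rfl, h'⟩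
    exact hu h'

theorem mem_cyclesThroughVertex {c : VertexCycle V} :
    c ∈ cyclesThroughVertex G v ↔ c.1.Chain G.Adj ∧ v ∈ c.1 := by
  simp [cyclesThroughVertex, directedCycles]

theorem mem_cyclesThroughArc {c : VertexCycle V} :
    c ∈ cyclesThroughArc G v u ↔
      c.1.Chain G.Adj ∧ ∃ hv : v ∈ c.1, c.1.next c.2.1 v hv = u := by
  simp [cyclesThroughArc, directedCycles]

theorem disjoint_cycles_deleteArc :
    Disjoint (cyclesThroughVertex (deleteArc G v u) v) (cyclesThroughArc G v u) := by
  rw [Finset.disjoint_left]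
  intro c h h'
  obtain ⟨h1, hv⟩ := mem_cyclesThroughVertex.mp h
  obtain ⟨_, _, hu⟩ := mem_cyclesThroughArc.mp h'
  exact ((chain_deleteArc_iff hv).mp h1).2 hu

open Classical in
theorem cyclesThroughVertex_eq_union :
    cyclesThroughVertex G v =
      cyclesThroughVertex (deleteArc G v u) v ∪ cyclesThroughArc G v u := by
  ext c
  rw [Finset.mem_union, mem_cyclesThroughVertex, mem_cyclesThroughVertex, mem_cyclesThroughArc]
  constructor
  · rintro ⟨h, hv⟩
    by_cases hu : c.1.next c.2.1 v hv = u
    · exact Or.inr ⟨h, hv, hu⟩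
    · exact Or.inl ⟨(chain_deleteArc_iff hv).mpr ⟨h, hu⟩, hv⟩
  · rintro (⟨h, hv⟩ | ⟨h, hv, -⟩)
    · exact ⟨((chain_deleteArc_iff hv).mp h).1, hv⟩
    · exact ⟨h, hv⟩

theorem sum_cyclesThroughVertex_eq (k : ℤ) :
    ∑ c ∈ cyclesThroughVertex G v, cycleTerm β γ G k c =
      ∑ c ∈ cyclesThroughVertex (deleteArc G v u) v, cycleTerm β γ (deleteArc G v u) k c +
        ∑ c ∈ cyclesThroughArc G v u, cycleTerm β γ G k c := by
  classical
  rw [cyclesThroughVertex_eq_union (u := u), Finset.sum_union disjoint_cycles_deleteArc]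
  refine congrArg (· + _) (Finset.sum_congr rfl fun c hc => ?_)
  rw [cycleTerm_deleteArc k (mem_cyclesThroughVertex.mp hc).2]

end Digraph

end HookImmanant

open HookImmanant in
theorem theorem1p3 {V : Type*} [Fintype V] [DecidableEq V] (G : Digraph V)
    (hloop : ∀ w, ¬ G.Adj w w) (β γ : ℝ) (k : ℤ) :
    (∀ v : V,
      hookPoly k (digraphH β γ G) =
        (Polynomial.X - Polynomial.C (β * (outDeg G v : ℝ))) *
            (hookPoly (k - 1) (digraphHDel β γ G {v}) + hookPoly k (digraphHDel β γ G {v})) +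
          ∑ c ∈ cyclesThroughVertex G v, cycleTerm β γ G k c) ∧
    (∀ v u : V, G.Adj v u →
      hookPoly k (digraphH β γ G) =
        hookPoly k (digraphH β γ (deleteArc G v u)) -
            Polynomial.C β *
              (hookPoly k (digraphHDel β γ (deleteArc G v u) {v}) +
                hookPoly (k - 1) (digraphHDel β γ (deleteArc G v u) {v})) +
          ∑ c ∈ cyclesThroughArc G v u, cycleTerm β γ G k c) := by
  refine ⟨hookPoly_vertex_expansion hloop k, fun v u huv => ?_⟩
  -- The out-degree of `v` drops by one, which yields the `β` term; the cycles through `v` that use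
  -- the arc remain as the last sum.
  rw [hookPoly_vertex_expansion hloop k v,
    hookPoly_vertex_expansion (G := deleteArc G v u) (fun w h => hloop w h.1) k v,
    sum_cyclesThroughVertex_eq (u := u), outDeg_eq_deleteArc_add_one huv,
    digraphHDel_deleteArc (Finset.mem_singleton_self v)]
  simp only [Nat.cast_add, Nat.cast_one, mul_add, map_add, mul_one]
  ring
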